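/- Let $m\ge 1$ be an integer. For a complex Hermitian $n\times n$ matrix $A$ (with $n \ge 1$) let $\rho_A$ be its largest eigenvalue, and put $\Delta^+(A)=\det(A)^{1/n}$ if $A$ is positive definite and $\Delta^+(A)=0$ otherwise. For $s>0$ define the $m$-finite K-transform and R-transform of (the spectral distribution of) $A$ by \[ \mathcal K^m_A(s)=-\frac{\partial}{\partial s}\ln\left(\int_{\rho_A}^{\infty}\bigl|e^{-xs}\,\Delta^+(xI-A)\bigr|^m\,dx\right)^{1/m}, \qquad \mathcal R^m_A(s)=\mathcal K^m_A(s)-\mathcal K^m_0(s), \] where $0$ is the zero matrix. For power series $f,g$ in $s$, write $f\equiv g \bmod s^k$ if the coefficients of $s^0,\dots,s^{k-1}$ in $f-g$ vanish. If $p,q$ are the characteristic polynomials of real symmetric $m\times m$ matrices $A',B'$ (that is, $p,q$ are monic of degree $m$ with only real roots), let \[ [p\boxplus_m q](x)=\mathbb E_Q\,\det\bigl(xI-A'-QB'Q^{T}\bigr), \] where $Q$ is distributed according to the Haar probability measure on the orthogonal group $O(m)$; this depends only on $p$ and $q$. **Lemma.** Let $A$ and $B$ be complex Hermitian $m\times m$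 matrices. Then each of $\mathcal R^m_A$, $\mathcal R^m_B$, $\mathcal R^m_{A+B}$ is given, for all sufficiently small $s>0$, by a convergent power series in $s$ (which is unique), and, with the R-transforms regarded as these power series, the following are equivalent: 1. $\mathcal R^m_A(s)+\mathcal R^m_B(s)\equiv \mathcal R^m_{A+B}(s) \bmod s^m$; 2. $\det(xI-A)\boxplus_m\det(xI-B)=\det(xI-A-B)$. -/

import Mathlib

open Polynomial MeasureTheory Filter Topology
open scoped ENNReal

namespace FiniteFree

open scoped ComplexOrder

/-! ### The orthogonal group and its Haar probability measure -/

/-- The group `O(m)` of real orthogonal `m × m` matrices. -/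
abbrev OrthGroup (m : ℕ) : Type := Matrix.orthogonalGroup (Fin m) ℝ

instance (m : ℕ) : MeasurableSpace (OrthGroup m) := borel _

instance (m : ℕ) : BorelSpace (OrthGroup m) := ⟨rfl⟩

instance (m : ℕ) : CompactSpace (OrthGroup m) := by
  have hK : IsCompact (X := Matrix (Fin m) (Fin m) ℝ) (Set.univ.pi fun _ : Fin m =>
      Set.univ.pi fun _ : Fin m => Metric.closedBall (0 : ℝ) 1) :=
    isCompact_univ_pi fun _ => isCompact_univ_pi fun _ => isCompact_closedBall _ _
  have hcl : IsClosed (Matrix.orthogonalGroup (Fin m) ℝ : Set (Matrix (Fin m) (Fin m) ℝ)) :=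
    isClosed_unitary
  refine isCompact_iff_compactSpace.mp
    (IsCompact.of_isClosed_subset (t := (Matrix.orthogonalGroup (Fin m) ℝ : Set _)) hK hcl ?_)
  intro U hU i _ j _
  simpa using entry_norm_bound_of_unitary (𝕜 := ℝ) hU i j

instance (m : ℕ) : SecondCountableTopology (OrthGroup m) := by
  have : SecondCountableTopology (Matrix (Fin m) (Fin m) ℝ) :=
    inferInstanceAs (SecondCountableTopology (Fin m → Fin m → ℝ))
  exact TopologicalSpace.Subtype.secondCountableTopology _

/-- The uniform distribution on `O(m)`: the Haar measure of total mass one. -/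
noncomputable def orthHaar (m : ℕ) : Measure (OrthGroup m) :=
  Measure.haarMeasure ⊤

instance (m : ℕ) : IsProbabilityMeasure (orthHaar m) :=
  ⟨by
    have h := Measure.haarMeasure_self (K₀ := (⊤ : TopologicalSpace.PositiveCompacts (OrthGroup m)))
    simpa [orthHaar] using h⟩

instance (m : ℕ) : (orthHaar m).IsHaarMeasure := by
  unfold orthHaar; infer_instance

/-! ### The symmetric additive convolution -/

/-- The polynomial `𝔼_Q det (x I - A - Q B Qᵀ)`, the expectation being over Haar distributed
orthogonal matrices `Q` and taken coefficient by coefficient. -/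
noncomputable def expectedCharpoly {m : ℕ} (A B : Matrix (Fin m) (Fin m) ℝ) : ℝ[X] :=
  ∑ k ∈ Finset.range (m + 1), monomial k
    (∫ Q : OrthGroup m,
      (A + (Q : Matrix (Fin m) (Fin m) ℝ) * B * (Q : Matrix (Fin m) (Fin m) ℝ).transpose).charpoly.coeff k
        ∂(orthHaar m))

/-- `expectedCharpoly A B` is the function `x ↦ 𝔼_Q det (x I - A - Q B Qᵀ)`. -/
theorem expectedCharpoly_eval {m : ℕ} (A B : Matrix (Fin m) (Fin m) ℝ) (x : ℝ) :
    (expectedCharpoly A B).eval x = ∫ Q : OrthGroup m,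
      (x • (1 : Matrix (Fin m) (Fin m) ℝ) - A -
        (Q : Matrix (Fin m) (Fin m) ℝ) * B * (Q : Matrix (Fin m) (Fin m) ℝ).transpose).det
          ∂(orthHaar m) := by
  have hcont : ∀ k : ℕ, Continuous fun Q : OrthGroup m =>
      (A + (Q : Matrix (Fin m) (Fin m) ℝ) * B *
        (Q : Matrix (Fin m) (Fin m) ℝ).transpose).charpoly.coeff k := by
    intro k
    have h (M : Matrix (Fin m) (Fin m) ℝ) : M.charpoly.coeff k = MvPolynomial.eval
        (fun ij : Fin m × Fin m => M ij.1 ij.2) ((Matrix.charpoly.univ ℝ (Fin m)).coeff k) :=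
      (Matrix.charpoly.univ_coeff_eval₂Hom (Fin m) (RingHom.id ℝ) (fun ij => M ij.1 ij.2) k).symm
    have hM : Continuous fun Q : OrthGroup m => A + (Q : Matrix (Fin m) (Fin m) ℝ) * B *
        (Q : Matrix (Fin m) (Fin m) ℝ).transpose := by fun_prop
    simp_rw [h]
    exact (MvPolynomial.continuous_eval _).comp
      (continuous_pi fun ij => hM.matrix_elem ij.1 ij.2)
  simp only [expectedCharpoly, eval_finsetSum, eval_monomial]
  simp_rw [← integral_mul_const]
  rw [← integral_finsetSum]
  · refine integral_congr_ae (Filter.Eventually.of_forall fun Q => ?_)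
    simp only
    rw [sub_sub, show x • (1 : Matrix (Fin m) (Fin m) ℝ) = Matrix.scalar _ x by
      simp [Matrix.smul_one_eq_diagonal], ← Matrix.eval_charpoly,
      eval_eq_sum_range' (n := m + 1)]
    simp
  · intro k _
    exact ((hcont k).integrable_of_hasCompactSupport
      (HasCompactSupport.of_compactSpace _)).mul_const _

open Classical in
/-- The symmetric additive convolution `p ⊞_m q`. If `p` and `q` are the characteristic polynomials
of real symmetric `m × m` matrices `A` and `B`, then it is `𝔼_Q det (x I - A - Q B Qᵀ)`, which does
not depend on the choice of `A` and `B` (`symmAddConv_charpoly`). Such `A`, `B` exist exactly when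
`p` and `q` are monic of degree `m` with only real roots; otherwise the value is `0`. -/
noncomputable def symmAddConv (m : ℕ) (p q : ℂ[X]) : ℂ[X] :=
  if h : (∃ A : Matrix (Fin m) (Fin m) ℝ, A.IsSymm ∧ A.charpoly.map (algebraMap ℝ ℂ) = p) ∧
      (∃ B : Matrix (Fin m) (Fin m) ℝ, B.IsSymm ∧ B.charpoly.map (algebraMap ℝ ℂ) = q)
  then (expectedCharpoly h.1.choose h.2.choose).map (algebraMap ℝ ℂ)
  else 0

theorem orthHaar_map_mul_right {m : ℕ} (V : OrthGroup m) :
    (orthHaar m).map (· * V) = orthHaar m := by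
  have : IsProbabilityMeasure ((orthHaar m).map (· * V)) :=
    Measure.isProbabilityMeasure_map (measurable_mul_const V).aemeasurable
  have h := Measure.haarMeasure_unique ((orthHaar m).map (· * V))
    (⊤ : TopologicalSpace.PositiveCompacts (OrthGroup m))
  have h1 : ((orthHaar m).map (· * V)) Set.univ = 1 := measure_univ
  rw [TopologicalSpace.PositiveCompacts.coe_top, h1, one_smul] at h
  exact h

theorem integral_orthHaar_mul_mul {m : ℕ} (U V : OrthGroup m) (f : OrthGroup m → ℝ) :
    ∫ Q, f (U * Q * V) ∂(orthHaar m) = ∫ Q, f Q ∂(orthHaar m) := by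
  rw [integral_mul_left_eq_self (μ := orthHaar m) (fun Q => f (Q * V)) U]
  have h := integral_map_equiv (μ := orthHaar m) (MeasurableEquiv.mulRight V) f
  rw [show ((orthHaar m).map (MeasurableEquiv.mulRight V)) = orthHaar m from
    orthHaar_map_mul_right V] at h
  simpa using h.symm

/-- Real symmetric matrices with equal characteristic polynomials are orthogonally conjugate. -/
theorem exists_conj {m : ℕ} {A B : Matrix (Fin m) (Fin m) ℝ} (hA : A.IsSymm) (hB : B.IsSymm)
    (h : A.charpoly = B.charpoly) : ∃ U : OrthGroup m,
      A = (U : Matrix (Fin m) (Fin m) ℝ) * B * (U : Matrix (Fin m) (Fin m) ℝ).transpose := by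
  have hA' : A.IsHermitian := by simpa [Matrix.IsHermitian] using hA.eq
  have hB' : B.IsHermitian := by simpa [Matrix.IsHermitian] using hB.eq
  have he := (hA'.eigenvalues_eq_eigenvalues_iff hB').2 h
  refine ⟨hA'.eigenvectorUnitary * star hB'.eigenvectorUnitary, ?_⟩
  have h1 := hA'.spectral_theorem
  have h2 := hB'.conjStarAlgAut_star_eigenvectorUnitary
  rw [he, ← h2, ← Unitary.conjStarAlgAut_mul_apply, Unitary.conjStarAlgAut_apply] at h1
  simpa [Matrix.star_eq_conjTranspose, Unitary.coe_star] using h1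

theorem expectedCharpoly_congr {m : ℕ} {A A' B B' : Matrix (Fin m) (Fin m) ℝ} (hA : A.IsSymm)
    (hA' : A'.IsSymm) (hB : B.IsSymm) (hB' : B'.IsSymm) (h : A.charpoly = A'.charpoly)
    (k : B.charpoly = B'.charpoly) : expectedCharpoly A B = expectedCharpoly A' B' := by
  obtain ⟨U, hU⟩ := exists_conj hA hA' h
  obtain ⟨V, hV⟩ := exists_conj hB' hB k.symm
  have hUU : (U : Matrix (Fin m) (Fin m) ℝ).transpose * (U : Matrix (Fin m) (Fin m) ℝ) = 1 := by
    simpa [Matrix.star_eq_conjTranspose] using (Matrix.mem_unitaryGroup_iff'.1 U.2)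
  unfold expectedCharpoly
  refine Finset.sum_congr rfl fun i _ => ?_
  congr 1
  rw [← integral_orthHaar_mul_mul U V]
  refine integral_congr_ae (Filter.Eventually.of_forall fun Q => ?_)
  have e : A + ((U * Q * V : OrthGroup m) : Matrix (Fin m) (Fin m) ℝ) * B *
        ((U * Q * V : OrthGroup m) : Matrix (Fin m) (Fin m) ℝ).transpose =
      (U : Matrix (Fin m) (Fin m) ℝ) * ((A' + (Q : Matrix (Fin m) (Fin m) ℝ) * B' *
        (Q : Matrix (Fin m) (Fin m) ℝ).transpose) *
          (U : Matrix (Fin m) (Fin m) ℝ).transpose) := by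
    rw [hV, hU]
    simp [Matrix.transpose_mul, mul_add, add_mul, mul_assoc]
  simp only
  rw [e, Matrix.charpoly_mul_comm, mul_assoc, hUU, mul_one]

/-- The defining formula of the convolution, for any real symmetric representatives. -/
theorem symmAddConv_charpoly {m : ℕ} {A B : Matrix (Fin m) (Fin m) ℝ} (hA : A.IsSymm)
    (hB : B.IsSymm) :
    symmAddConv m (A.charpoly.map (algebraMap ℝ ℂ)) (B.charpoly.map (algebraMap ℝ ℂ)) =
      (expectedCharpoly A B).map (algebraMap ℝ ℂ) := by
  have h : (∃ A' : Matrix (Fin m) (Fin m) ℝ, A'.IsSymm ∧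
      A'.charpoly.map (algebraMap ℝ ℂ) = A.charpoly.map (algebraMap ℝ ℂ)) ∧
      (∃ B' : Matrix (Fin m) (Fin m) ℝ, B'.IsSymm ∧
      B'.charpoly.map (algebraMap ℝ ℂ) = B.charpoly.map (algebraMap ℝ ℂ)) :=
    ⟨⟨A, hA, rfl⟩, ⟨B, hB, rfl⟩⟩
  have inj := Polynomial.map_injective (algebraMap ℝ ℂ) (algebraMap ℝ ℂ).injective
  rw [symmAddConv, dif_pos h]
  rw [expectedCharpoly_congr h.1.choose_spec.1 hA h.2.choose_spec.1 hB
    (inj h.1.choose_spec.2) (inj h.2.choose_spec.2)]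

/-- The characteristic polynomial of a complex Hermitian matrix is that of a real symmetric one,
so that `symmAddConv` has its intended value on such polynomials. -/
theorem exists_symm_charpoly_eq {m : ℕ} {A : Matrix (Fin m) (Fin m) ℂ} (hA : A.IsHermitian) :
    ∃ A' : Matrix (Fin m) (Fin m) ℝ, A'.IsSymm ∧
      A'.charpoly.map (algebraMap ℝ ℂ) = A.charpoly := by
  refine ⟨Matrix.diagonal hA.eigenvalues, Matrix.isSymm_diagonal _, ?_⟩
  rw [hA.charpoly_eq, Matrix.charpoly_diagonal, Polynomial.map_prod]
  simp

/-! ### The finite transforms -/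

open Classical in
/-- The normalized determinant: `det(A)^{1/n}` for positive definite `A`, and `0` otherwise. -/
noncomputable def fkdet {n : ℕ} (A : Matrix (Fin n) (Fin n) ℂ) : ℝ :=
  if A.PosDef then A.det.re ^ (1 / (n : ℝ)) else 0

/-- The largest eigenvalue of a Hermitian matrix. -/
noncomputable def maxEigenvalue {n : ℕ} (A : Matrix (Fin n) (Fin n) ℂ) : ℝ :=
  sSup (spectrum ℝ A)

/-- The norm `‖e^{-xs} fkdet(xI - A)‖_m` in the variable `x`, with respect to Lebesgue measure on
the domain `(maxEigenvalue A, ∞)`, as a function of `s`. -/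
noncomputable def expDetNorm (m : ℕ) {n : ℕ} (A : Matrix (Fin n) (Fin n) ℂ) (s : ℝ) : ℝ :=
  (eLpNorm (fun x : ℝ => Real.exp (-(x * s)) *
      fkdet ((x : ℂ) • (1 : Matrix (Fin n) (Fin n) ℂ) - A))
    (m : ℝ≥0∞) (volume.restrict (Set.Ioi (maxEigenvalue A)))).toReal

/-- The `m`-finite K-transform (of the spectral distribution of `A`), a function of `s > 0`. -/
noncomputable def finiteK (m : ℕ) {n : ℕ} (A : Matrix (Fin n) (Fin n) ℂ) (s : ℝ) : ℝ :=
  -deriv (fun t : ℝ => Real.log (expDetNorm m A t)) s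

/-- The `m`-finite R-transform (of the spectral distribution of `A`), a function of `s > 0`. -/
noncomputable def finiteR (m : ℕ) {n : ℕ} (A : Matrix (Fin n) (Fin n) ℂ) (s : ℝ) : ℝ :=
  finiteK m A s - finiteK m (0 : Matrix (Fin n) (Fin n) ℂ) s

/-- `f` is represented by the power series `φ` for all small `s > 0`. -/
def HasExpansion (f : ℝ → ℝ) (φ : PowerSeries ℝ) : Prop :=
  ∀ᶠ s in 𝓝[>] (0 : ℝ), HasSum (fun k : ℕ => PowerSeries.coeff k φ * s ^ k) (f s)

open Classical in
/-- The power series of a function of `s > 0` at `s = 0` (and `0` if there is none). -/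
noncomputable def seriesAtZero (f : ℝ → ℝ) : PowerSeries ℝ :=
  if h : ∃ φ, HasExpansion f φ then h.choose else 0

/-- A power series expansion is unique. -/
theorem HasExpansion.unique {f : ℝ → ℝ} {φ ψ : PowerSeries ℝ} (hφ : HasExpansion f φ)
    (hψ : HasExpansion f ψ) : φ = ψ := by
  let c : ℕ → ℝ := fun k => PowerSeries.coeff k φ - PowerSeries.coeff k ψ
  have hc : ∀ᶠ s in 𝓝[>] (0 : ℝ), HasSum (fun k : ℕ => c k * s ^ k) 0 := by
    filter_upwards [hφ, hψ] with s h1 h2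
    simpa [c, sub_mul] using h1.sub h2
  let p : FormalMultilinearSeries ℝ ℝ ℝ := FormalMultilinearSeries.ofScalars ℝ c
  have hrad : 0 < p.radius := by
    obtain ⟨s, hs, hs0⟩ := (hc.and self_mem_nhdsWithin).exists
    have hs0 : 0 < s := hs0
    refine lt_of_lt_of_le (b := (s.toNNReal : ℝ≥0∞)) (by simpa using hs0) ?_
    refine p.le_radius_of_tendsto (l := 0) ?_
    have := hs.summable.tendsto_atTop_zero.norm
    simpa [p, FormalMultilinearSeries.ofScalars_norm, abs_of_pos hs0, hs0.le] using this
  have hp := p.hasFPowerSeriesOnBall hrad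
  have hz : ∃ᶠ z in 𝓝[≠] (0 : ℝ), p.sum z = 0 := by
    refine Frequently.filter_mono (Eventually.frequently ?_)
      (nhdsWithin_mono (0 : ℝ) (fun x (hx : x ∈ Set.Ioi 0) => (ne_of_gt hx : x ≠ 0)))
    filter_upwards [hc] with s hs
    simpa [p, FormalMultilinearSeries.sum, mul_comm] using hs.tsum_eq
  have hz' := hp.hasFPowerSeriesAt.analyticAt.frequently_zero_iff_eventually_zero.1 hz
  have hp0 : p = 0 := (hp.hasFPowerSeriesAt.congr hz').eq_zero
  ext k
  have := congrArg (fun q => FormalMultilinearSeries.coeff q k) hp0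
  rw [show FormalMultilinearSeries.coeff 0 k = (0 : ℝ) from rfl] at this
  simpa [p, c, sub_eq_zero] using this

theorem seriesAtZero_eq {f : ℝ → ℝ} {φ : PowerSeries ℝ} (h : HasExpansion f φ) :
    seriesAtZero f = φ := by
  have h' : ∃ φ, HasExpansion f φ := ⟨φ, h⟩
  rw [seriesAtZero, dif_pos h']
  exact h'.choose_spec.unique h

/-- The `m`-finite R-transform as a power series in `s`. -/
noncomputable def finiteRSeries (m : ℕ) {n : ℕ} (A : Matrix (Fin n) (Fin n) ℂ) : PowerSeries ℝ :=
  seriesAtZero (finiteR m A)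

/-- Congruence `φ ≡ ψ mod s^k` of power series: the part of `φ - ψ` of degree `< k` vanishes. -/
def SeriesModEq (k : ℕ) (φ ψ : PowerSeries ℝ) : Prop :=
  PowerSeries.trunc k (φ - ψ) = 0

end FiniteFree

/-! For `x` above the largest eigenvalue `ρ` of `A`, the `m`-th power of `e^{-xs} Δ⁺(xI - A)` is
`e^{-msx} χ_A(x)`. The `m`-th power of the norm is thus a Laplace transform of `χ_A` on `(ρ, ∞)`,
and equals `H_A(s) / (ms)^{m+1}` with `H_A` entire and `H_A(0) = m!`. The pole is the same for every
`A`, and `H_0` is constant, so `R_A = -(1/m) H_A'/H_A` (`finiteR_eventuallyEq`).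

Up to order `m` the Taylor coefficients of `H_A` do not see `ρ`: the `i`-th one is `m^i (m-i)!
[x^{m-i}] χ_A` (`coeff_taylorSeries_laplaceNumerator`). In the same normalisation the convolution is
a truncated Cauchy product (`factorial_mul_coeff_expectedCharpoly`), so condition 2 says `H_A H_B ≡
m! H_{A+B} mod s^{m+1}`. Both sides have constant term `m!²`, so this can be tested on logarithmic
derivatives mod `s^m` (`X_pow_dvd_sub_iff_of_mul_eq_derivative`), which is condition 1.

The product formula comes from expanding `det(xI - A - QBQᵀ)` in minors: Haar invariance makes each
averaged minor of size `k` a multiple of the `k`-th elementary symmetric function, and `B = I` fixes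
the constant. -/

namespace FiniteFree

/-! ### Determinant expansions and minors of `Q D Qᵀ` -/

section Expansion

variable {n R : Type*} [Fintype n] [DecidableEq n] [CommRing R]

/-- The matrix `M` with the rows in `S` replaced by those of the identity matrix. -/
def withUnitRows (S : Finset n) (M : Matrix n n R) : Matrix n n R :=
  Matrix.of fun i j => if i ∈ S then (1 : Matrix n n R) i j else M i j

/-- Multilinearity in the rows: `S` records which rows are taken from the diagonal matrix, and each
of these is a scalar times a unit row. -/
theorem det_diagonal_add (c : n → R) (M : Matrix n n R) :
    (Matrix.diagonal c + M).det =
      ∑ S : Finset n, (∏ i ∈ S, c i) * (withUnitRows S M).det := by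
  have h := (Matrix.detRowAlternating (n := n) (R := R)).map_add_univ
    (fun i => Matrix.diagonal c i) (fun i => M i)
  refine h.trans (Finset.sum_congr rfl fun S _ => ?_)
  have e : S.piecewise (fun i => Matrix.diagonal c i) (fun i => M i) =
      fun i => (if i ∈ S then c i else 1) • (withUnitRows S M) i := by
    funext i j
    by_cases hi : i ∈ S
    · simp [Finset.piecewise, hi, withUnitRows, Matrix.diagonal_apply, Matrix.one_apply]
    · simp [Finset.piecewise, hi, withUnitRows]
  rw [e]
  refine (AlternatingMap.map_smul_univ _ _ _).trans ?_
  rw [Finset.prod_ite_mem, Finset.univ_inter]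
  rfl

/-- A form of the Cauchy–Binet formula: principal minors of `Q D Qᵀ` with `D` diagonal are
linear combinations of the squarefree monomials in the diagonal entries. -/
theorem exists_det_withUnitRows_eq_sum (S : Finset n) (Q : Matrix n n ℝ) :
    ∃ u : Finset n → ℝ, ∀ b : n → ℝ,
      (withUnitRows S (Q * Matrix.diagonal b * Q.transpose)).det =
        ∑ T ∈ Finset.univ.powersetCard Sᶜ.card, (∏ i ∈ T, b i) * u T := by
  -- Every row must be a sum over the same index set `n`. A unit row does not depend on the index,
  -- so it is spread evenly with weight `1 / card n`.
  let v : n → n → n → ℝ := fun i j l => if i ∈ S then (1 : Matrix n n ℝ) i l else Q l j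
  let d : (n → n) → ℝ := fun f =>
    (∏ i, if i ∈ S then (Fintype.card n : ℝ)⁻¹ else Q i (f i)) *
      Matrix.det (Matrix.of fun i => v i (f i))
  refine ⟨fun T => ∑ f with Sᶜ.image f = T, d f, fun b => ?_⟩
  have hrow : withUnitRows S (Q * Matrix.diagonal b * Q.transpose) =
      Matrix.of fun i => ∑ j,
        (if i ∈ S then (Fintype.card n : ℝ)⁻¹ else Q i j * b j) • v i j := by
    ext i l
    have : Nonempty n := ⟨i⟩
    by_cases hi : i ∈ S
    · simp [hi, v, withUnitRows]
    · simp [hi, v, withUnitRows, Matrix.mul_apply, Matrix.diagonal_apply]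
  have hexp : (withUnitRows S (Q * Matrix.diagonal b * Q.transpose)).det =
      ∑ f : n → n, (∏ i ∈ Sᶜ, b (f i)) * d f := by
    rw [hrow]
    have h := (Matrix.detRowAlternating (n := n) (R := ℝ)).toMultilinearMap.map_sum
      (fun i j => (if i ∈ S then (Fintype.card n : ℝ)⁻¹ else Q i j * b j) • v i j)
    refine h.trans (Finset.sum_congr rfl fun f _ => ?_)
    refine (MultilinearMap.map_smul_univ _ _ _).trans ?_
    have : (∏ i, if i ∈ S then (Fintype.card n : ℝ)⁻¹ else Q i (f i) * b (f i)) =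
        (∏ i ∈ Sᶜ, b (f i)) * ∏ i, if i ∈ S then (Fintype.card n : ℝ)⁻¹ else Q i (f i) := by
      rw [← Finset.univ_inter Sᶜ, ← Finset.prod_ite_mem, ← Finset.prod_mul_distrib]
      refine Finset.prod_congr rfl fun i _ => ?_
      by_cases hi : i ∈ S <;> simp [hi, mul_comm]
    exact (congrArg (· * _) this).trans (mul_assoc _ _ _)
  -- A repeated value of `f` off `S` gives two equal rows. The surviving monomials are therefore
  -- squarefree, of degree `card Sᶜ`.
  have hinj : ∀ f : n → n, ¬ Set.InjOn f (Sᶜ : Finset n) → d f = 0 := by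
    intro f hf
    simp only [Set.InjOn, not_forall] at hf
    obtain ⟨i, hi, j, hj, hij, hne⟩ := hf
    have hi : i ∉ S := by simpa using hi
    have hj : j ∉ S := by simpa using hj
    have : Matrix.det (Matrix.of fun i => v i (f i)) = 0 :=
      Matrix.det_zero_of_row_eq hne (by ext l; simp [v, hi, hj, hij])
    simp [d, this]
  rw [hexp]
  simp_rw [Finset.mul_sum]
  rw [Finset.sum_comm' (t' := Finset.univ.filter fun f : n → n => (Sᶜ.image f).card = Sᶜ.card)
    (s' := fun f => {Sᶜ.image f})]
  · rw [Finset.sum_filter]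
    refine Finset.sum_congr rfl fun f _ => ?_
    rw [Finset.sum_singleton]
    split_ifs with hc
    · rw [Finset.prod_image (Finset.card_image_iff.1 hc)]
    · rw [hinj f (fun h => hc (Finset.card_image_iff.2 h)), mul_zero]
  · intro T f
    simp only [Finset.mem_powersetCard, Finset.subset_univ, true_and, Finset.mem_filter,
      Finset.mem_univ, Finset.mem_singleton]
    grind

/-- Evaluating at the indicator of `T` isolates the coefficient of the monomial `T`, since no other
set of the same cardinality lies inside `T`. -/
theorem det_withUnitRows_conj_diagonal (S : Finset n) (Q : Matrix n n ℝ) (b : n → ℝ) :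
    (withUnitRows S (Q * Matrix.diagonal b * Q.transpose)).det =
      ∑ T ∈ Finset.univ.powersetCard Sᶜ.card, (∏ i ∈ T, b i) *
        (withUnitRows S (Q * Matrix.diagonal ((T : Set n).indicator 1) * Q.transpose)).det := by
  obtain ⟨u, hu⟩ := exists_det_withUnitRows_eq_sum S Q
  rw [hu]
  refine Finset.sum_congr rfl fun T hT => ?_
  rw [hu, Finset.sum_eq_single_of_mem T hT]
  · rw [Finset.prod_eq_one (f := fun i => (T : Set n).indicator (1 : n → ℝ) i)
      fun i hi => by simp [hi], one_mul]
  · intro T' hT' hne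
    rw [Finset.mem_powersetCard] at hT hT'
    have : ¬ T' ⊆ T := fun h => hne (Finset.eq_of_subset_of_card_le h (by omega))
    obtain ⟨i, hi, hi'⟩ := Finset.not_subset.1 this
    rw [Finset.prod_eq_zero hi (by simp [hi']), zero_mul]

theorem charpoly_diagonal_indicator (T : Finset n) :
    (Matrix.diagonal ((T : Set n).indicator (1 : n → ℝ))).charpoly =
      (X - C 1) ^ T.card * X ^ (Fintype.card n - T.card) := by
  rw [Matrix.charpoly_diagonal, ← Finset.prod_mul_prod_compl T, ← Finset.card_compl,
    ← Finset.prod_const, ← Finset.prod_const]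
  congr 1
  · exact Finset.prod_congr rfl fun i hi => by simp [hi]
  · exact Finset.prod_congr rfl fun i hi => by simp [Finset.mem_compl.1 hi]

end Expansion

/-! ### Haar averages and the coefficients of the convolution -/

section Haar

variable {m : ℕ}

theorem continuous_det_withUnitRows (S : Finset (Fin m)) (b : Fin m → ℝ) :
    Continuous fun Q : OrthGroup m => (withUnitRows S ((Q : Matrix (Fin m) (Fin m) ℝ) *
      Matrix.diagonal b * (Q : Matrix (Fin m) (Fin m) ℝ).transpose)).det := by
  refine Continuous.matrix_det (continuous_matrix fun i j => ?_)
  by_cases hi : i ∈ S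
  · simp only [withUnitRows, Matrix.of_apply, hi, if_true]
    exact continuous_const
  · simp only [withUnitRows, Matrix.of_apply, hi, if_false]
    have hM : Continuous fun Q : OrthGroup m => (Q : Matrix (Fin m) (Fin m) ℝ) *
        Matrix.diagonal b * (Q : Matrix (Fin m) (Fin m) ℝ).transpose := by fun_prop
    exact hM.matrix_elem i j

theorem integrable_det_withUnitRows (S : Finset (Fin m)) (b : Fin m → ℝ) :
    Integrable (fun Q : OrthGroup m => (withUnitRows S ((Q : Matrix (Fin m) (Fin m) ℝ) *
      Matrix.diagonal b * (Q : Matrix (Fin m) (Fin m) ℝ).transpose)).det) (orthHaar m) :=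
  (continuous_det_withUnitRows S b).integrable_of_hasCompactSupport
    (HasCompactSupport.of_compactSpace _)

/-- The two diagonal matrices are orthogonally conjugate, and the conjugating matrix is absorbed
into `Q` by right invariance. -/
theorem integral_det_withUnitRows_congr (S : Finset (Fin m)) {b b' : Fin m → ℝ}
    (h : (Matrix.diagonal b).charpoly = (Matrix.diagonal b').charpoly) :
    ∫ Q : OrthGroup m, (withUnitRows S ((Q : Matrix (Fin m) (Fin m) ℝ) *
      Matrix.diagonal b * (Q : Matrix (Fin m) (Fin m) ℝ).transpose)).det ∂(orthHaar m) =
    ∫ Q : OrthGroup m, (withUnitRows S ((Q : Matrix (Fin m) (Fin m) ℝ) *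
      Matrix.diagonal b' * (Q : Matrix (Fin m) (Fin m) ℝ).transpose)).det ∂(orthHaar m) := by
  obtain ⟨U, hU⟩ := exists_conj (Matrix.isSymm_diagonal _) (Matrix.isSymm_diagonal _) h
  rw [← integral_orthHaar_mul_mul 1 U (fun Q : OrthGroup m =>
    (withUnitRows S ((Q : Matrix (Fin m) (Fin m) ℝ) *
      Matrix.diagonal b' * (Q : Matrix (Fin m) (Fin m) ℝ).transpose)).det)]
  refine integral_congr_ae (Eventually.of_forall fun Q => ?_)
  simp only
  rw [hU]
  simp [Matrix.transpose_mul, mul_assoc]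

/-- The averaged coefficient of a monomial `T` depends only on `card T`, because indicators of sets
of equal size have the same characteristic polynomial. -/
theorem integral_det_withUnitRows (S : Finset (Fin m)) (b : Fin m → ℝ) :
    ∫ Q : OrthGroup m, (withUnitRows S ((Q : Matrix (Fin m) (Fin m) ℝ) *
      Matrix.diagonal b * (Q : Matrix (Fin m) (Fin m) ℝ).transpose)).det ∂(orthHaar m) =
    (∑ T ∈ Finset.univ.powersetCard Sᶜ.card, ∏ i ∈ T, b i) / (m.choose Sᶜ.card : ℝ) := by
  set k := Sᶜ.card with hk
  have hkm : k ≤ m := by simpa using Finset.card_le_univ Sᶜ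
  obtain ⟨T₀, -, hT₀⟩ := Finset.exists_subset_card_eq
    (s := (Finset.univ : Finset (Fin m))) (n := k) (by simpa using hkm)
  set w : ℝ := ∫ Q : OrthGroup m, (withUnitRows S ((Q : Matrix (Fin m) (Fin m) ℝ) *
      Matrix.diagonal ((T₀ : Set (Fin m)).indicator 1) *
        (Q : Matrix (Fin m) (Fin m) ℝ).transpose)).det ∂(orthHaar m)
  have key : ∀ b : Fin m → ℝ,
      ∫ Q : OrthGroup m, (withUnitRows S ((Q : Matrix (Fin m) (Fin m) ℝ) *
      Matrix.diagonal b * (Q : Matrix (Fin m) (Fin m) ℝ).transpose)).det ∂(orthHaar m) =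
      (∑ T ∈ Finset.univ.powersetCard k, ∏ i ∈ T, b i) * w := by
    intro b
    simp_rw [fun Q => det_withUnitRows_conj_diagonal S Q b]
    rw [integral_finsetSum _ fun T _ => (integrable_det_withUnitRows S _).const_mul _,
      Finset.sum_mul]
    refine Finset.sum_congr rfl fun T hT => ?_
    rw [integral_const_mul]
    congr 1
    refine integral_det_withUnitRows_congr S ?_
    rw [charpoly_diagonal_indicator, charpoly_diagonal_indicator, hT₀,
      (Finset.mem_powersetCard.1 hT).2]
  -- At `b = 1` every determinant is `1`, which forces `w = 1 / m.choose k`.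
  have h1 := key 1
  have hQ : ∀ Q : OrthGroup m, (withUnitRows S ((Q : Matrix (Fin m) (Fin m) ℝ) *
      Matrix.diagonal 1 * (Q : Matrix (Fin m) (Fin m) ℝ).transpose)).det = 1 := by
    intro Q
    have : (Q : Matrix (Fin m) (Fin m) ℝ) * (Q : Matrix (Fin m) (Fin m) ℝ).transpose = 1 := by
      simpa [Matrix.star_eq_conjTranspose] using (Matrix.mem_unitaryGroup_iff.1 Q.2)
    rw [show (Matrix.diagonal (1 : Fin m → ℝ)) = 1 from Matrix.diagonal_one, mul_one, this]
    have : withUnitRows S (1 : Matrix (Fin m) (Fin m) ℝ) = 1 := by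
      ext i j; simp [withUnitRows]
    rw [this, Matrix.det_one]
  simp only [hQ, Pi.one_apply, Finset.prod_const_one, Finset.sum_const, Finset.card_powersetCard,
    Finset.card_univ, Fintype.card_fin, integral_const, probReal_univ, nsmul_eq_mul, mul_one,
    smul_eq_mul] at h1
  have hc : (m.choose k : ℝ) ≠ 0 := by exact_mod_cast (Nat.choose_pos hkm).ne'
  rw [key, eq_div_iff hc, mul_assoc, mul_comm w, ← h1, mul_one]

/-- Both sides are the coefficient of `X^k` in the Taylor shift `∏ (X + (x - a i))`. -/
theorem sum_prod_sub_eq_hasseDeriv (a : Fin m → ℝ) (x : ℝ) {k : ℕ} (hk : k ≤ m) :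
    ∑ S : Finset (Fin m) with Sᶜ.card = k, ∏ i ∈ S, (x - a i) =
      (hasseDeriv k (∏ i, (X - C (a i)))).eval x := by
  rw [← taylor_coeff, ← taylorAlgHom_apply, map_prod]
  have : ∀ i, taylorAlgHom x (X - C (a i)) = X + C (x - a i) := by
    intro i
    simp [taylor_apply]
    ring
  simp_rw [this]
  rw [Finset.prod_X_add_C_coeff _ _ (by simpa using hk)]
  refine Finset.sum_congr ?_ fun _ _ => rfl
  ext S
  have := Finset.card_le_univ S
  simp [Finset.mem_powersetCard, Finset.card_compl] at this ⊢
  omega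

/-- Terms are grouped by `k = card Sᶜ`; the averaged minor involves the `k`-th elementary symmetric
function of `-b`, which is the coefficient of `X^(m-k)` in `∏ (X - b i)`. -/
theorem expectedCharpoly_diagonal (a b : Fin m → ℝ) :
    expectedCharpoly (Matrix.diagonal a) (Matrix.diagonal b) =
      ∑ k ∈ Finset.range (m + 1), C ((∏ i, (X - C (b i))).coeff (m - k) / (m.choose k : ℝ)) *
        hasseDeriv k (∏ i, (X - C (a i))) := by
  refine Polynomial.funext fun x => ?_
  rw [expectedCharpoly_eval]
  have h : ∀ Q : OrthGroup m, (x • (1 : Matrix (Fin m) (Fin m) ℝ) - Matrix.diagonal a -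
        (Q : Matrix (Fin m) (Fin m) ℝ) * Matrix.diagonal b *
          (Q : Matrix (Fin m) (Fin m) ℝ).transpose).det =
      ∑ S : Finset (Fin m), (∏ i ∈ S, (x - a i)) *
        (withUnitRows S ((Q : Matrix (Fin m) (Fin m) ℝ) * Matrix.diagonal (-b) *
          (Q : Matrix (Fin m) (Fin m) ℝ).transpose)).det := by
    intro Q
    rw [← det_diagonal_add]
    congr 1
    rw [Matrix.smul_one_eq_diagonal, Matrix.diagonal_sub, sub_eq_add_neg,
      show Matrix.diagonal (-b) = -Matrix.diagonal b from (Matrix.diagonal_neg b).symm,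
      Matrix.mul_neg, Matrix.neg_mul]
  simp_rw [h]
  rw [integral_finsetSum _ fun S _ => (integrable_det_withUnitRows S _).const_mul _]
  simp_rw [integral_const_mul, integral_det_withUnitRows, eval_finsetSum, eval_mul, eval_C]
  rw [← Finset.sum_fiberwise_of_maps_to (t := Finset.range (m + 1))
    (g := fun S : Finset (Fin m) => Sᶜ.card)
    (fun S _ => by simpa [Nat.lt_succ_iff] using Finset.card_le_univ Sᶜ)]
  refine Finset.sum_congr rfl fun k hk => ?_
  have hk : k ≤ m := Nat.lt_succ_iff.1 (Finset.mem_range.1 hk)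
  rw [← sum_prod_sub_eq_hasseDeriv a x hk, Finset.mul_sum]
  refine Finset.sum_congr rfl fun S hS => ?_
  rw [(Finset.mem_filter.1 hS).2, mul_comm]
  congr 2
  have : ∀ i, (X - C (b i)) = X + C ((-b) i) := fun i => by simp [sub_eq_add_neg]
  simp_rw [this]
  rw [Finset.prod_X_add_C_coeff _ _ (by simp)]
  simp [Nat.sub_sub_self hk]

/-- The coefficients of the convolution, normalised by factorials. -/
theorem factorial_mul_coeff_expectedCharpoly (a b : Fin m → ℝ) {i : ℕ} (hi : i ≤ m) :
    (m.factorial : ℝ) * (((m - i).factorial : ℝ) *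
        (expectedCharpoly (Matrix.diagonal a) (Matrix.diagonal b)).coeff (m - i)) =
      ∑ x ∈ Finset.HasAntidiagonal.antidiagonal i,
        (((m - x.1).factorial : ℝ) * (∏ i, (X - C (a i))).coeff (m - x.1)) *
        (((m - x.2).factorial : ℝ) * (∏ i, (X - C (b i))).coeff (m - x.2)) := by
  have hdeg : (∏ i, (X - C (a i))).natDegree = m := by
    rw [natDegree_finsetProd_X_sub_C_eq_card]; simp
  rw [expectedCharpoly_diagonal]
  simp only [finsetSum_coeff, coeff_C_mul, hasseDeriv_coeff]
  -- Terms with `k > i` vanish: they involve coefficients of index `m - i + k > m`.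
  rw [← Finset.sum_subset (Finset.range_subset_range.2 (Nat.succ_le_succ hi)),
    ← Finset.Nat.sum_antidiagonal_eq_sum_range_succ
      (fun x _ : ℕ => (∏ i, (X - C (b i)) : ℝ[X]).coeff (m - x) / (m.choose x : ℝ) *
        (((m - i + x).choose x : ℝ) * (∏ i, (X - C (a i)) : ℝ[X]).coeff (m - i + x))) i,
    ← Finset.Nat.sum_antidiagonal_swap, Finset.mul_sum, Finset.mul_sum]
  · refine Finset.sum_congr rfl fun x hx => ?_
    have hx := Finset.HasAntidiagonal.mem_antidiagonal.1 hx
    obtain ⟨u, v⟩ := x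
    simp only [Prod.swap] at hx ⊢
    have e : m - i + v = m - u := by omega
    rw [e, Nat.cast_choose ℝ (show v ≤ m by omega), Nat.cast_choose ℝ (show v ≤ m - u by omega),
      show m - u - v = m - i by omega]
    have h1 : ((m - i).factorial : ℝ) ≠ 0 := by positivity
    have h2 : (m.factorial : ℝ) ≠ 0 := by positivity
    have h3 : (v.factorial : ℝ) ≠ 0 := by positivity
    field_simp
  · intro k _ hk
    rw [coeff_eq_zero_of_natDegree_lt (n := m - i + k), mul_zero, mul_zero]
    rw [hdeg]
    simp only [Finset.mem_range] at hk
    omega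

end Haar

/-! ### Logarithmic derivatives of formal power series -/

section Formal

theorem X_pow_succ_dvd_iff_derivative {D : PowerSeries ℝ} (h0 : PowerSeries.constantCoeff D = 0)
    (k : ℕ) : (PowerSeries.X : PowerSeries ℝ) ^ (k + 1) ∣ D ↔
      (PowerSeries.X : PowerSeries ℝ) ^ k ∣ PowerSeries.derivative ℝ D := by
  rw [PowerSeries.X_pow_dvd_iff, PowerSeries.X_pow_dvd_iff]
  constructor
  · intro h j hj
    rw [PowerSeries.coeff_derivative, h (j + 1) (by omega), zero_mul]
  · intro h j hj
    rcases j with _ | j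
    · simpa using h0
    · have := h j (by omega)
      rw [PowerSeries.coeff_derivative, mul_eq_zero] at this
      exact this.resolve_right (by positivity)

/-- Two power series with the same constant coefficient agree to order `m + 1` if and only if
their logarithmic derivatives agree to order `m`. -/
theorem X_pow_dvd_sub_iff_of_mul_eq_derivative {f g φ ψ : PowerSeries ℝ} {c : ℝ} (hc : c ≠ 0)
    (hf : f * φ = PowerSeries.C c * PowerSeries.derivative ℝ f)
    (hg : g * ψ = PowerSeries.C c * PowerSeries.derivative ℝ g)
    (hf0 : PowerSeries.constantCoeff f ≠ 0)
    (hfg : PowerSeries.constantCoeff f = PowerSeries.constantCoeff g) (m : ℕ) :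
    (PowerSeries.X : PowerSeries ℝ) ^ m ∣ φ - ψ ↔
      (PowerSeries.X : PowerSeries ℝ) ^ (m + 1) ∣ f - g := by
  have uf : IsUnit f := PowerSeries.isUnit_iff_constantCoeff.2 hf0.isUnit
  have ug : IsUnit g := PowerSeries.isUnit_iff_constantCoeff.2 (hfg ▸ hf0.isUnit)
  have uc : IsUnit (PowerSeries.C c) := hc.isUnit.map _
  have h0 : PowerSeries.constantCoeff (f - g) = 0 := by rw [map_sub, hfg, sub_self]
  -- With `D = f - g`, the numerator `f' g - f g'` equals `D' g - D g'`.
  have key : f * g * (φ - ψ) = PowerSeries.C c *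
      (PowerSeries.derivative ℝ (f - g) * g - (f - g) * PowerSeries.derivative ℝ g) := by
    rw [map_sub]
    linear_combination g * hf - f * hg
  have hiff : (PowerSeries.X : PowerSeries ℝ) ^ m ∣ φ - ψ ↔ (PowerSeries.X : PowerSeries ℝ) ^ m ∣
      PowerSeries.derivative ℝ (f - g) * g - (f - g) * PowerSeries.derivative ℝ g := by
    rw [← (uf.mul ug).dvd_mul_left, key, uc.dvd_mul_left]
  rw [hiff]
  constructor
  · intro h
    -- Bootstrapping: if `X^k ∣ D` and `k ≤ m`, then `X^k ∣ D' g`, hence `X^k ∣ D'` and, as `D` has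
    -- no constant term, `X^(k+1) ∣ D`.
    have : ∀ k ≤ m + 1, (PowerSeries.X : PowerSeries ℝ) ^ k ∣ f - g := by
      intro k
      induction k with
      | zero => simp
      | succ k ih =>
        intro hk
        rw [X_pow_succ_dvd_iff_derivative h0, ← ug.dvd_mul_right]
        have h1 := (pow_dvd_pow (PowerSeries.X : PowerSeries ℝ) (by omega : k ≤ m)).trans h
        have h2 := (ih (by omega)).mul_right (PowerSeries.derivative ℝ g)
        simpa using h1.add h2
    exact this _ le_rfl
  · intro h
    exact (((X_pow_succ_dvd_iff_derivative h0 m).1 h).mul_right _).sub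
      (((pow_dvd_pow _ (Nat.le_succ m)).trans h).mul_right _)

theorem seriesModEq_iff {k : ℕ} {φ ψ : PowerSeries ℝ} :
    SeriesModEq k φ ψ ↔ (PowerSeries.X : PowerSeries ℝ) ^ k ∣ φ - ψ := by
  rw [SeriesModEq, PowerSeries.X_pow_dvd_iff, Polynomial.ext_iff]
  simp only [PowerSeries.coeff_trunc, Polynomial.coeff_zero, ite_eq_right_iff]

end Formal

/-! ### Calculus of expansions at `0⁺` -/

section Expansion

theorem HasExpansion.mul {f g : ℝ → ℝ} {φ ψ : PowerSeries ℝ} (hf : HasExpansion f φ)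
    (hg : HasExpansion g ψ) : HasExpansion (fun s => f s * g s) (φ * ψ) := by
  filter_upwards [hf, hg] with s h1 h2
  have n1 := summable_norm_iff.2 h1.summable
  have n2 := summable_norm_iff.2 h2.summable
  have h := (summable_norm_sum_mul_antidiagonal_of_summable_norm n1 n2).of_norm.hasSum
  rw [← tsum_mul_tsum_eq_tsum_sum_antidiagonal_of_summable_norm n1 n2, h1.tsum_eq,
    h2.tsum_eq] at h
  refine h.congr_fun fun k => ?_
  rw [PowerSeries.coeff_mul, Finset.sum_mul]
  refine Finset.sum_congr rfl fun x hx => ?_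
  rw [← Finset.HasAntidiagonal.mem_antidiagonal.1 hx, pow_add]
  ring

theorem HasExpansion.const_mul {f : ℝ → ℝ} {φ : PowerSeries ℝ} (c : ℝ) (hf : HasExpansion f φ) :
    HasExpansion (fun s => c * f s) (PowerSeries.C c * φ) := by
  filter_upwards [hf] with s h
  simpa [mul_assoc] using h.mul_left c

theorem HasExpansion.congr {f g : ℝ → ℝ} {φ : PowerSeries ℝ} (hf : HasExpansion f φ)
    (h : ∀ᶠ s in 𝓝[>] (0 : ℝ), f s = g s) : HasExpansion g φ := by
  filter_upwards [hf, h] with s h1 h2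
  exact h2 ▸ h1

/-- The Taylor series at `0`. -/
noncomputable def taylorSeries (f : ℝ → ℝ) : PowerSeries ℝ :=
  PowerSeries.mk fun k => iteratedDeriv k f 0 / k.factorial

theorem hasExpansion_taylorSeries {f : ℝ → ℝ} (hf : AnalyticAt ℝ f 0) :
    HasExpansion f (taylorSeries f) := by
  have h := hf.hasFPowerSeriesAt.eventually_hasSum
  filter_upwards [nhdsWithin_le_nhds h] with s hs
  simpa [taylorSeries, FormalMultilinearSeries.ofScalars_apply_eq, mul_comm] using hs

theorem taylorSeries_deriv (f : ℝ → ℝ) :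
    taylorSeries (deriv f) = PowerSeries.derivative ℝ (taylorSeries f) := by
  ext k
  rw [PowerSeries.coeff_derivative, taylorSeries, taylorSeries, PowerSeries.coeff_mk,
    PowerSeries.coeff_mk, iteratedDeriv_succ', Nat.factorial_succ]
  push_cast
  field_simp

theorem constantCoeff_taylorSeries (f : ℝ → ℝ) :
    PowerSeries.constantCoeff (taylorSeries f) = f 0 := by
  rw [← PowerSeries.coeff_zero_eq_constantCoeff_apply, taylorSeries, PowerSeries.coeff_mk]
  simp

/-- The expansion of a logarithmic derivative. -/
theorem exists_hasExpansion_logDeriv {f : ℝ → ℝ} (hf : AnalyticAt ℝ f 0) (h0 : f 0 ≠ 0) (c : ℝ) :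
    ∃ φ, HasExpansion (fun s => c * (deriv f s / f s)) φ ∧
      taylorSeries f * φ = PowerSeries.C c * PowerSeries.derivative ℝ (taylorSeries f) := by
  have h : AnalyticAt ℝ (fun s => c * (deriv f s / f s)) 0 :=
    analyticAt_const.mul (hf.deriv.div hf h0)
  refine ⟨_, hasExpansion_taylorSeries h, ?_⟩
  -- Both series expand `f · (c f'/f) = c f'`, so uniqueness of expansions gives the identity.
  refine ((hasExpansion_taylorSeries hf).mul (hasExpansion_taylorSeries h)).unique ?_
  rw [← taylorSeries_deriv]
  refine ((hasExpansion_taylorSeries hf.deriv).const_mul c).congr ?_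
  filter_upwards [nhdsWithin_le_nhds (hf.continuousAt.eventually_ne h0)] with s hs
  field_simp

end Expansion

/-! ### The Laplace transform of a polynomial on a half-line -/

section Laplace

/-- `(m s) ^ (m + 1)` times the Laplace transform of the polynomial `p` on `(ρ, ∞)` at `m s`. -/
noncomputable def laplaceNumerator (m : ℕ) (ρ : ℝ) (p : ℝ[X]) (s : ℝ) : ℝ :=
  Real.exp (-(m * ρ) * s) * ∑ j ∈ Finset.range (m + 1),
    (m : ℝ) ^ j * ((m - j).factorial * (taylor ρ p).coeff (m - j)) * s ^ j

theorem analyticAt_laplaceNumerator (m : ℕ) (ρ : ℝ) (p : ℝ[X]) (s : ℝ) :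
    AnalyticAt ℝ (laplaceNumerator m ρ p) s := by
  unfold laplaceNumerator
  fun_prop

theorem laplaceNumerator_zero {m : ℕ} (ρ : ℝ) {p : ℝ[X]} (hp : p.Monic) (hd : p.natDegree = m) :
    laplaceNumerator m ρ p 0 = m.factorial := by
  have h : (taylor ρ p).coeff m = 1 := by
    rw [← hd, coeff_taylor_natDegree]
    exact hp
  rw [laplaceNumerator, Finset.sum_eq_single_of_mem 0 (by simp)
    (fun j _ hj => by rw [zero_pow hj, mul_zero])]
  simp [h]

/-- The value is independent of `ρ` for a reason: moving `ρ` changes the Laplace integral by one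
over a bounded interval, entire in `s`, hence changes the numerator only from order `m + 1` on. The
computation multiplies the exponential series by the polynomial factor and recognises the Taylor
shift by `-ρ` that undoes the shift by `ρ`. -/
theorem coeff_taylorSeries_laplaceNumerator {m : ℕ} (ρ : ℝ) {p : ℝ[X]} (hd : p.natDegree = m)
    {i : ℕ} (hi : i ≤ m) :
    PowerSeries.coeff i (taylorSeries (laplaceNumerator m ρ p)) =
      (m : ℝ) ^ i * ((m - i).factorial * p.coeff (m - i)) := by
  let c : ℕ → ℝ := fun j => (m : ℝ) ^ j * ((m - j).factorial * (taylor ρ p).coeff (m - j))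
  have h1 : HasExpansion (fun s => Real.exp (-(m * ρ) * s))
      (PowerSeries.mk fun k => (-(m * ρ)) ^ k / k.factorial) := by
    refine Eventually.of_forall fun s => ?_
    have := NormedSpace.expSeries_div_hasSum_exp (𝔸 := ℝ) (-(m * ρ) * s)
    rw [← Real.exp_eq_exp_ℝ] at this
    refine this.congr_fun fun k => ?_
    rw [PowerSeries.coeff_mk, mul_pow]
    ring
  have h2 : HasExpansion (fun s => ∑ j ∈ Finset.range (m + 1), c j * s ^ j)
      (PowerSeries.mk fun k => if k ≤ m then c k else 0) := by
    refine Eventually.of_forall fun s => ?_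
    have := hasSum_sum_of_ne_finset_zero (L := .unconditional ℕ) (s := Finset.range (m + 1))
      (f := fun k => PowerSeries.coeff k (PowerSeries.mk fun k => if k ≤ m then c k else 0) * s ^ k)
      (fun k hk => by
        have : ¬ k ≤ m := by simpa [Nat.lt_succ_iff] using hk
        simp [this])
    rwa [Finset.sum_congr rfl (g := fun j => c j * s ^ j) (fun k hk => by
        have : k ≤ m := by simpa [Nat.lt_succ_iff] using hk
        simp [this])] at this
  have h3 := (hasExpansion_taylorSeries (analyticAt_laplaceNumerator m ρ p 0)).unique (h1.mul h2)
  rw [h3, PowerSeries.coeff_mul]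
  have h4 : p.coeff (m - i) = ∑ u ∈ Finset.range (i + 1),
      ((m - i + u).choose (m - i) : ℝ) * (taylor ρ p).coeff (m - i + u) * (-ρ) ^ u := by
    conv_lhs => rw [show p = taylor (-ρ) (taylor ρ p) by simp [taylor_taylor]]
    have hn : (hasseDeriv (m - i) (taylor ρ p)).natDegree < i + 1 := by
      have := natDegree_hasseDeriv_le (taylor ρ p) (m - i)
      rw [natDegree_taylor, hd] at this
      omega
    rw [taylor_coeff, eval_eq_sum_range' hn]
    refine Finset.sum_congr rfl fun u _ => ?_
    rw [hasseDeriv_coeff, add_comm u]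
  rw [Finset.Nat.sum_antidiagonal_eq_sum_range_succ_mk, h4, Finset.mul_sum, Finset.mul_sum]
  refine Finset.sum_congr rfl fun u hu => ?_
  have hu : u ≤ i := Nat.lt_succ_iff.1 (Finset.mem_range.1 hu)
  simp only [PowerSeries.coeff_mk, c]
  rw [if_pos (by omega), Nat.cast_choose ℝ (show m - i ≤ m - i + u by omega),
    show m - i + u - (m - i) = u by omega, show m - (i - u) = m - i + u by omega]
  have e : (m : ℝ) ^ i = (m : ℝ) ^ u * (m : ℝ) ^ (i - u) := by
    rw [← pow_add]; congr 1; omega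
  have e2 : (-(m * ρ : ℝ)) ^ u = (m : ℝ) ^ u * (-ρ) ^ u := by rw [← mul_pow]; congr 1; ring
  have f1 : ((m - i).factorial : ℝ) ≠ 0 := by positivity
  have f2 : (u.factorial : ℝ) ≠ 0 := by positivity
  rw [e, e2]
  field_simp

theorem integrableOn_pow_mul_exp_neg_mul {σ : ℝ} (hσ : 0 < σ) (k : ℕ) :
    IntegrableOn (fun x : ℝ => x ^ k * Real.exp (-(σ * x))) (Set.Ioi 0) := by
  have := integrableOn_rpow_mul_exp_neg_mul_rpow (p := 1) (s := k) (b := σ)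
    (by linarith [(Nat.cast_nonneg k : (0 : ℝ) ≤ k)]) one_pos hσ
  simpa using this

theorem integral_pow_mul_exp_neg_mul {σ : ℝ} (hσ : 0 < σ) (k : ℕ) :
    ∫ x in Set.Ioi (0 : ℝ), x ^ k * Real.exp (-(σ * x)) = k.factorial / σ ^ (k + 1) := by
  have := Real.integral_rpow_mul_exp_neg_mul_Ioi (a := k + 1) (r := σ) (by positivity) hσ
  simp only [add_sub_cancel_right, Real.rpow_natCast, Real.Gamma_nat_eq_factorial] at this
  rw [this, show ((k : ℝ) + 1) = ((k + 1 : ℕ) : ℝ) by push_cast; rfl, Real.rpow_natCast,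
    one_div, inv_pow]
  field_simp

/-- After the substitution `x ↦ x + ρ`, each power `x^k` contributes `k! / (ms)^(k+1)`; the common
denominator is `(ms)^(m+1)`, and `j = m - k` indexes the numerator. -/
theorem integral_exp_neg_mul_eval {m : ℕ} (hm : 1 ≤ m) (ρ : ℝ) {p : ℝ[X]} (hd : p.natDegree = m)
    {s : ℝ} (hs : 0 < s) :
    ∫ x in Set.Ioi ρ, Real.exp (-(m * s * x)) * p.eval x =
      laplaceNumerator m ρ p s / (m * s) ^ (m + 1) := by
  have hm0 : (0 : ℝ) < m := by exact_mod_cast hm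
  have hσ : 0 < (m : ℝ) * s := by positivity
  have hmp := (measurePreserving_add_right (volume : Measure ℝ) ρ).setIntegral_preimage_emb
    (measurableEmbedding_addRight ρ) (fun x => Real.exp (-(m * s * x)) * p.eval x) (Set.Ioi ρ)
  rw [← hmp]
  have hpre : (fun x => x + ρ) ⁻¹' Set.Ioi ρ = Set.Ioi (0 : ℝ) := by ext x; simp
  rw [hpre]
  have hx : ∀ x : ℝ, Real.exp (-(m * s * (x + ρ))) * p.eval (x + ρ) =
      ∑ k ∈ Finset.range (m + 1), Real.exp (-(m * ρ) * s) * (taylor ρ p).coeff k *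
        (x ^ k * Real.exp (-(m * s * x))) := by
    intro x
    rw [← taylor_eval, eval_eq_sum_range' (n := m + 1) (by rw [natDegree_taylor, hd]; simp),
      Finset.mul_sum]
    refine Finset.sum_congr rfl fun k _ => ?_
    rw [show -(m * s * (x + ρ)) = -(m * ρ) * s + -(m * s * x) by ring, Real.exp_add]
    ring
  simp_rw [hx]
  rw [integral_finsetSum _ fun k _ =>
    (integrableOn_pow_mul_exp_neg_mul hσ k).integrable.const_mul _]
  simp_rw [integral_const_mul, integral_pow_mul_exp_neg_mul hσ]
  rw [laplaceNumerator, mul_div_assoc, Finset.sum_div, Finset.mul_sum, ← Finset.sum_range_reflect]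
  refine Finset.sum_congr rfl fun k hk => ?_
  have hk : k ≤ m := Nat.lt_succ_iff.1 (Finset.mem_range.1 hk)
  rw [show m + 1 - 1 - k = m - k by omega,
    show ((m : ℝ) * s) ^ (m + 1) = (m * s) ^ (m - k + 1) * (m ^ k * s ^ k) by
      rw [← mul_pow, ← pow_add]; congr 1; omega]
  field_simp

end Laplace

/-! ### The transforms of a Hermitian matrix -/

section Transform

open scoped ComplexOrder

variable {m : ℕ} {A : Matrix (Fin m) (Fin m) ℂ}

theorem maxEigenvalue_eq (hA : A.IsHermitian) :
    maxEigenvalue A = sSup (Set.range hA.eigenvalues) := by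
  rw [maxEigenvalue, hA.spectrum_real_eq_range_eigenvalues]

theorem eigenvalues_le_maxEigenvalue (hA : A.IsHermitian) (i : Fin m) :
    hA.eigenvalues i ≤ maxEigenvalue A := by
  rw [maxEigenvalue_eq hA]
  exact le_csSup (Set.finite_range _).bddAbove ⟨i, rfl⟩

theorem isHermitian_smul_one_sub (hA : A.IsHermitian) (x : ℝ) :
    ((x : ℂ) • (1 : Matrix (Fin m) (Fin m) ℂ) - A).IsHermitian := by
  refine Matrix.IsHermitian.sub ?_ hA
  simp [Matrix.IsHermitian, Matrix.conjTranspose_smul]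

theorem posDef_smul_one_sub (hA : A.IsHermitian) {x : ℝ} (hx : maxEigenvalue A < x) :
    ((x : ℂ) • (1 : Matrix (Fin m) (Fin m) ℂ) - A).PosDef := by
  have hH := isHermitian_smul_one_sub hA x
  rw [hH.posDef_iff_eigenvalues_pos]
  intro i
  have hi : hH.eigenvalues i ∈ spectrum ℝ ((x : ℂ) • (1 : Matrix (Fin m) (Fin m) ℂ) - A) := by
    rw [hH.spectrum_real_eq_range_eigenvalues]; exact ⟨i, rfl⟩
  generalize hH.eigenvalues i = y at hi
  rw [show (x : ℂ) • (1 : Matrix (Fin m) (Fin m) ℂ) = algebraMap ℝ _ x by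
    simp [Algebra.algebraMap_eq_smul_one], ← spectrum.singleton_sub_eq,
    hA.spectrum_real_eq_range_eigenvalues] at hi
  obtain ⟨z, hz, _, ⟨j, rfl⟩, h⟩ := hi
  rw [Set.mem_singleton_iff] at hz
  have := eigenvalues_le_maxEigenvalue hA j
  simp only at h
  rw [← h, hz]
  linarith

/-- The real polynomial `∏ (X - λ)` over the eigenvalues `λ` of a Hermitian matrix. -/
noncomputable def eigenPoly (hA : A.IsHermitian) : ℝ[X] := ∏ i, (X - C (hA.eigenvalues i))

theorem monic_eigenPoly (hA : A.IsHermitian) : (eigenPoly hA).Monic :=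
  monic_prod_X_sub_C _ _

theorem natDegree_eigenPoly (hA : A.IsHermitian) : (eigenPoly hA).natDegree = m := by
  rw [eigenPoly, natDegree_finsetProd_X_sub_C_eq_card]; simp

theorem map_eigenPoly (hA : A.IsHermitian) :
    (eigenPoly hA).map (algebraMap ℝ ℂ) = A.charpoly := by
  rw [hA.charpoly_eq, eigenPoly, Polynomial.map_prod]
  simp

theorem det_smul_one_sub_re (hA : A.IsHermitian) (x : ℝ) :
    ((x : ℂ) • (1 : Matrix (Fin m) (Fin m) ℂ) - A).det.re = (eigenPoly hA).eval x := by
  rw [show (x : ℂ) • (1 : Matrix (Fin m) (Fin m) ℂ) = Matrix.scalar _ (x : ℂ) by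
      simp [Matrix.smul_one_eq_diagonal], ← Matrix.eval_charpoly, ← map_eigenPoly hA,
      eval_map_algebraMap, show (x : ℂ) = algebraMap ℝ ℂ x from rfl, aeval_algebraMap_apply]
  simp

theorem eval_eigenPoly_pos (hA : A.IsHermitian) {x : ℝ} (hx : maxEigenvalue A < x) :
    0 < (eigenPoly hA).eval x := by
  rw [eigenPoly, eval_prod]
  refine Finset.prod_pos fun i _ => ?_
  have := eigenvalues_le_maxEigenvalue hA i
  simp only [eval_sub, eval_X, eval_C]
  linarith

/-- The norm exponent equals the matrix size, so the `m`-th power cancels the `m`-th root of the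
determinant and leaves a polynomial times an exponential. -/
theorem expDetNorm_eq (hm : 1 ≤ m) (hA : A.IsHermitian) {s : ℝ} (hs : 0 < s) :
    expDetNorm m A s =
      (laplaceNumerator m (maxEigenvalue A) (eigenPoly hA) s / (m * s) ^ (m + 1)) ^
        (m : ℝ)⁻¹ := by
  have hm0 : (m : ℝ) ≠ 0 := by positivity
  set g : ℝ → ℝ := fun x => Real.exp (-(x * s)) * ((eigenPoly hA).eval x) ^ (1 / (m : ℝ))
  have hg : ∀ x ∈ Set.Ioi (maxEigenvalue A), Real.exp (-(x * s)) *
      fkdet ((x : ℂ) • (1 : Matrix (Fin m) (Fin m) ℂ) - A) = g x := by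
    intro x hx
    rw [fkdet, if_pos (posDef_smul_one_sub hA hx), det_smul_one_sub_re hA]
  have hmeas : Measurable g := by
    have : Measurable fun x => (eigenPoly hA).eval x := (eigenPoly hA).continuous.measurable
    fun_prop
  rw [expDetNorm, eLpNorm_congr_ae (ae_restrict_of_forall_mem measurableSet_Ioi hg),
    toReal_eLpNorm hmeas.aestronglyMeasurable,
    lpNorm_eq_integral_norm_rpow_toReal (by simpa using hm0) (by simp)
      hmeas.aestronglyMeasurable, ← integral_exp_neg_mul_eval hm _ (natDegree_eigenPoly hA) hs]
  rw [ENNReal.toReal_natCast]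
  congr 1
  refine setIntegral_congr_fun measurableSet_Ioi fun x hx => ?_
  have hp := eval_eigenPoly_pos hA hx
  simp only [g]
  rw [Real.norm_of_nonneg (by positivity), Real.rpow_natCast, mul_pow, ← Real.exp_nat_mul,
    ← Real.rpow_natCast ((eigenPoly hA).eval x ^ _), ← Real.rpow_mul hp.le, one_div,
    inv_mul_cancel₀ hm0, Real.rpow_one]
  congr 2
  ring

theorem laplaceNumerator_eigenPoly_zero (hA : A.IsHermitian) :
    laplaceNumerator m (maxEigenvalue A) (eigenPoly hA) 0 = m.factorial :=
  laplaceNumerator_zero _ (monic_eigenPoly hA) (natDegree_eigenPoly hA)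

theorem finiteK_eventuallyEq (hm : 1 ≤ m) (hA : A.IsHermitian) :
    ∀ᶠ s in 𝓝[>] (0 : ℝ), finiteK m A s =
      -(m : ℝ)⁻¹ * (deriv (laplaceNumerator m (maxEigenvalue A) (eigenPoly hA)) s /
        laplaceNumerator m (maxEigenvalue A) (eigenPoly hA) s) +
      (m : ℝ)⁻¹ * ((m + 1) / s) := by
  have hm0 : (0 : ℝ) < m := by exact_mod_cast hm
  set H := laplaceNumerator m (maxEigenvalue A) (eigenPoly hA)
  have hpos : ∀ᶠ s in 𝓝 (0 : ℝ), 0 < H s :=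
    (analyticAt_laplaceNumerator m _ _ 0).continuousAt.eventually
      (lt_mem_nhds (by rw [laplaceNumerator_eigenPoly_zero]; positivity))
  filter_upwards [nhdsWithin_le_nhds hpos.eventually_nhds, self_mem_nhdsWithin] with s hs hs0
  have hs0 : 0 < s := hs0
  -- The closed form needs `t > 0` and its logarithm needs `H t > 0`; both hold on a neighbourhood
  -- of `s`, as differentiation requires.
  have heq : (fun t => Real.log (expDetNorm m A t)) =ᶠ[𝓝 s]
      fun t => (m : ℝ)⁻¹ * (Real.log (H t) - (m + 1) * Real.log (m * t)) := by
    filter_upwards [hs, lt_mem_nhds hs0] with t ht ht0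
    have : 0 < (m : ℝ) * t := by positivity
    rw [expDetNorm_eq hm hA ht0, Real.log_rpow (by positivity), Real.log_div ht.ne' (by positivity),
      Real.log_pow]
    push_cast
    rfl
  have hH : HasDerivAt H (deriv H s) s :=
    (analyticAt_laplaceNumerator m _ _ s).differentiableAt.hasDerivAt
  have hd := (((hH.log hs.self_of_nhds.ne').sub
    ((((hasDerivAt_id s).const_mul (m : ℝ)).log (mul_pos hm0 hs0).ne').const_mul
      ((m : ℝ) + 1))).const_mul (m : ℝ)⁻¹)
  rw [finiteK, heq.deriv_eq]
  have := hd.deriv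
  refine (congrArg Neg.neg this).trans ?_
  rw [id_eq]
  field_simp
  ring

theorem maxEigenvalue_zero : maxEigenvalue (0 : Matrix (Fin m) (Fin m) ℂ) = 0 := by
  rw [maxEigenvalue_eq Matrix.isHermitian_zero,
    (Matrix.isHermitian_zero (n := Fin m) (α := ℂ)).eigenvalues_eq_zero_iff.2 rfl]
  rcases isEmpty_or_nonempty (Fin m) with h | h
  · rw [Set.range_eq_empty, Real.sSup_empty]
  · exact (congrArg sSup (Set.range_const (c := (0 : ℝ)))).trans (csSup_singleton _)

theorem laplaceNumerator_X_pow (s : ℝ) :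
    laplaceNumerator m 0 (X ^ m) s = m.factorial := by
  rw [laplaceNumerator, Finset.sum_eq_single_of_mem 0 (by simp)]
  · simp
  · intro j hj hj0
    have : j ≤ m := Nat.lt_succ_iff.1 (Finset.mem_range.1 hj)
    rw [taylor_zero, coeff_X_pow, if_neg (by omega)]
    simp

/-- For the zero matrix the numerator is the constant `m!`, so its K-transform is exactly the common
pole, and subtracting it leaves the logarithmic derivative. -/
theorem finiteR_eventuallyEq (hm : 1 ≤ m) (hA : A.IsHermitian) :
    ∀ᶠ s in 𝓝[>] (0 : ℝ), -(m : ℝ)⁻¹ *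
      (deriv (laplaceNumerator m (maxEigenvalue A) (eigenPoly hA)) s /
        laplaceNumerator m (maxEigenvalue A) (eigenPoly hA) s) = finiteR m A s := by
  have h0 : laplaceNumerator m (maxEigenvalue (0 : Matrix (Fin m) (Fin m) ℂ))
      (eigenPoly (Matrix.isHermitian_zero (n := Fin m) (α := ℂ))) = fun _ => (m.factorial : ℝ) := by
    funext s
    rw [maxEigenvalue_zero, eigenPoly,
      (Matrix.isHermitian_zero (n := Fin m) (α := ℂ)).eigenvalues_eq_zero_iff.2 rfl]
    simpa using laplaceNumerator_X_pow s
  filter_upwards [finiteK_eventuallyEq hm hA,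
    finiteK_eventuallyEq hm (Matrix.isHermitian_zero (n := Fin m) (α := ℂ))] with s h1 h2
  rw [finiteR, h1, h2, h0]
  simp

/-- The expansion of the R-transform, characterised by a differential equation. -/
theorem hasExpansion_finiteR (hm : 1 ≤ m) (hA : A.IsHermitian) :
    HasExpansion (finiteR m A) (finiteRSeries m A) ∧
      taylorSeries (laplaceNumerator m (maxEigenvalue A) (eigenPoly hA)) * finiteRSeries m A =
        PowerSeries.C (-(m : ℝ)⁻¹) * PowerSeries.derivative ℝ
          (taylorSeries (laplaceNumerator m (maxEigenvalue A) (eigenPoly hA))) := by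
  obtain ⟨φ, h1, h2⟩ := exists_hasExpansion_logDeriv
    (analyticAt_laplaceNumerator m (maxEigenvalue A) (eigenPoly hA) 0)
    (by rw [laplaceNumerator_eigenPoly_zero]; positivity) (-(m : ℝ)⁻¹)
  have h := h1.congr (finiteR_eventuallyEq hm hA)
  rw [finiteRSeries, seriesAtZero_eq h]
  exact ⟨h, h2⟩

theorem symmAddConv_charpoly_eq_iff {B C : Matrix (Fin m) (Fin m) ℂ} (hA : A.IsHermitian)
    (hB : B.IsHermitian) (hC : C.IsHermitian) :
    symmAddConv m A.charpoly B.charpoly = C.charpoly ↔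
      expectedCharpoly (Matrix.diagonal hA.eigenvalues) (Matrix.diagonal hB.eigenvalues) =
        eigenPoly hC := by
  rw [← map_eigenPoly hA, ← map_eigenPoly hB, ← map_eigenPoly hC,
    show eigenPoly hA = (Matrix.diagonal hA.eigenvalues).charpoly from
      (Matrix.charpoly_diagonal _).symm,
    show eigenPoly hB = (Matrix.diagonal hB.eigenvalues).charpoly from
      (Matrix.charpoly_diagonal _).symm,
    symmAddConv_charpoly (Matrix.isSymm_diagonal _) (Matrix.isSymm_diagonal _)]
  exact (Polynomial.map_injective (algebraMap ℝ ℂ) (algebraMap ℝ ℂ).injective).eq_iff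

/-- For `i ≤ m` the coefficient of `s^i` on the right is the discrepancy of the coefficients of
`x^(m-i)` on the left, times the nonzero factor `m^i m! (m-i)!`. -/
theorem expectedCharpoly_eq_iff_coeff (hm : 1 ≤ m) {B C : Matrix (Fin m) (Fin m) ℂ}
    (hA : A.IsHermitian) (hB : B.IsHermitian) (hC : C.IsHermitian) :
    expectedCharpoly (Matrix.diagonal hA.eigenvalues) (Matrix.diagonal hB.eigenvalues) =
        eigenPoly hC ↔
    (PowerSeries.X : PowerSeries ℝ) ^ (m + 1) ∣
      taylorSeries (laplaceNumerator m (maxEigenvalue A) (eigenPoly hA)) *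
        taylorSeries (laplaceNumerator m (maxEigenvalue B) (eigenPoly hB)) -
      PowerSeries.C (m.factorial : ℝ) *
        taylorSeries (laplaceNumerator m (maxEigenvalue C) (eigenPoly hC)) := by
  have hm0 : (m : ℝ) ≠ 0 := by positivity
  have hcoeff : ∀ i ≤ m, PowerSeries.coeff i
      (taylorSeries (laplaceNumerator m (maxEigenvalue A) (eigenPoly hA)) *
        taylorSeries (laplaceNumerator m (maxEigenvalue B) (eigenPoly hB)) -
      PowerSeries.C (m.factorial : ℝ) *
        taylorSeries (laplaceNumerator m (maxEigenvalue C) (eigenPoly hC))) =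
      (m : ℝ) ^ i * m.factorial * (m - i).factorial *
        ((expectedCharpoly (Matrix.diagonal hA.eigenvalues)
          (Matrix.diagonal hB.eigenvalues)).coeff (m - i) - (eigenPoly hC).coeff (m - i)) := by
    intro i hi
    rw [map_sub, PowerSeries.coeff_C_mul, PowerSeries.coeff_mul,
      coeff_taylorSeries_laplaceNumerator _ (natDegree_eigenPoly hC) hi]
    have h := factorial_mul_coeff_expectedCharpoly hA.eigenvalues hB.eigenvalues hi
    have e : ∑ x ∈ Finset.HasAntidiagonal.antidiagonal i,
        PowerSeries.coeff x.1
          (taylorSeries (laplaceNumerator m (maxEigenvalue A) (eigenPoly hA))) *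
        PowerSeries.coeff x.2
          (taylorSeries (laplaceNumerator m (maxEigenvalue B) (eigenPoly hB))) =
        (m : ℝ) ^ i * ∑ x ∈ Finset.HasAntidiagonal.antidiagonal i,
        (((m - x.1).factorial : ℝ) * (eigenPoly hA).coeff (m - x.1)) *
        (((m - x.2).factorial : ℝ) * (eigenPoly hB).coeff (m - x.2)) := by
      rw [Finset.mul_sum]
      refine Finset.sum_congr rfl fun x hx => ?_
      have hx := Finset.HasAntidiagonal.mem_antidiagonal.1 hx
      rw [coeff_taylorSeries_laplaceNumerator _ (natDegree_eigenPoly hA) (by omega),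
        coeff_taylorSeries_laplaceNumerator _ (natDegree_eigenPoly hB) (by omega), ← hx, pow_add]
      ring
    rw [e]
    simp only [eigenPoly] at h ⊢
    rw [← h]
    ring
  rw [PowerSeries.X_pow_dvd_iff]
  constructor
  · intro h i hi
    rw [hcoeff i (by omega), h, sub_self, mul_zero]
  · intro h
    ext j
    rcases le_or_gt j m with hj | hj
    · have h1 := h (m - j) (by omega)
      rw [hcoeff _ (by omega), Nat.sub_sub_self hj, mul_eq_zero, sub_eq_zero] at h1
      exact h1.resolve_left (by positivity)
    · rw [coeff_eq_zero_of_natDegree_lt (p := eigenPoly hC) (by rwa [natDegree_eigenPoly]),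
        expectedCharpoly]
      simp only [finsetSum_coeff, coeff_monomial]
      refine Finset.sum_eq_zero fun k hk => if_neg ?_
      have := Finset.mem_range.1 hk
      omega

end Transform

end FiniteFree

/-! ### The equivalence -/

theorem mainTheorem2 (m : ℕ) (hm : 1 ≤ m) (A B : Matrix (Fin m) (Fin m) ℂ)
    (hA : A.IsHermitian) (hB : B.IsHermitian) :
    (FiniteFree.HasExpansion (FiniteFree.finiteR m A) (FiniteFree.finiteRSeries m A) ∧
      FiniteFree.HasExpansion (FiniteFree.finiteR m B) (FiniteFree.finiteRSeries m B) ∧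
      FiniteFree.HasExpansion (FiniteFree.finiteR m (A + B))
        (FiniteFree.finiteRSeries m (A + B))) ∧
    (FiniteFree.SeriesModEq m
        (FiniteFree.finiteRSeries m A + FiniteFree.finiteRSeries m B)
        (FiniteFree.finiteRSeries m (A + B)) ↔
      FiniteFree.symmAddConv m A.charpoly B.charpoly = (A + B).charpoly) := by
  have hC := hA.add hB
  obtain ⟨eA, dA⟩ := FiniteFree.hasExpansion_finiteR hm hA
  obtain ⟨eB, dB⟩ := FiniteFree.hasExpansion_finiteR hm hB
  obtain ⟨eC, dC⟩ := FiniteFree.hasExpansion_finiteR hm hC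
  refine ⟨⟨eA, eB, eC⟩, ?_⟩
  have hm0 : (m : ℝ) ≠ 0 := by positivity
  have hf : (m.factorial : ℝ) ≠ 0 := by positivity
  rw [FiniteFree.seriesModEq_iff, FiniteFree.symmAddConv_charpoly_eq_iff hA hB hC,
    FiniteFree.expectedCharpoly_eq_iff_coeff hm hA hB hC]
  -- Here `f = H_A H_B`, whose logarithmic derivative is a sum by the Leibniz rule, and `g = m!
  -- H_{A+B}`, where the factor `m!` matches the constant terms without affecting the logarithmic
  -- derivative.
  refine FiniteFree.X_pow_dvd_sub_iff_of_mul_eq_derivative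
    (c := -(m : ℝ)⁻¹) (neg_ne_zero.2 (inv_ne_zero hm0)) ?_ ?_ ?_ ?_ m
  · rw [Derivation.leibniz, smul_eq_mul, smul_eq_mul]
    linear_combination FiniteFree.taylorSeries (FiniteFree.laplaceNumerator m
      (FiniteFree.maxEigenvalue B) (FiniteFree.eigenPoly hB)) * dA +
      FiniteFree.taylorSeries (FiniteFree.laplaceNumerator m
      (FiniteFree.maxEigenvalue A) (FiniteFree.eigenPoly hA)) * dB
  · rw [Derivation.leibniz, smul_eq_mul, smul_eq_mul, PowerSeries.derivative_C]
    linear_combination PowerSeries.C (m.factorial : ℝ) * dC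
  · simp [FiniteFree.constantCoeff_taylorSeries, FiniteFree.laplaceNumerator_eigenPoly_zero, hf]
  · simp [FiniteFree.constantCoeff_taylorSeries, FiniteFree.laplaceNumerator_eigenPoly_zero]
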